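/- For a finite family of points $u_1,\dots,u_M$ in $\mathbb R^n$ put $$P(u_1,\dots,u_M)=\int_{\mathbb R^n}\max_{1\le i\le M} e^{-|x-u_i|^2}\,dx ,$$ where $|\cdot|$ is the Euclidean norm. Let $N\le n$ and let $r_1,\dots,r_N\ge 0$ be real numbers. Among all families $v_1,\dots,v_N$ of vectors in $\mathbb R^n$ with $|v_i|=r_i$ for all $i$, the (finite) value $$P(v_1,-v_1,\dots,v_N,-v_N)$$ is maximized when the $v_i$ are pairwise orthogonal. That is, there are pairwise orthogonal $w_1,\dots,w_N\in\mathbb R^n$ with $|w_i|=r_i$, and for every such orthogonal family and every family $v_1,\dots,v_N\in\mathbb R^n$ with $|v_i|=r_i$, $$P(v_1,-v_1,\dots,v_N,-v_N)\le P(w_1,-w_1,\dots,w_N,-w_N).$$ -/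

import Mathlib

open MeasureTheory

noncomputable section

/-- The function `x ↦ max_i exp (-|x - u i|²)` of a family `u` of points of `ℝⁿ`.
For a finite nonempty index type the supremum is a maximum. -/
def maxGauss {n : ℕ} {ι : Type*} (u : ι → EuclideanSpace ℝ (Fin n))
    (x : EuclideanSpace ℝ (Fin n)) : ℝ :=
  ⨆ i, Real.exp (-‖x - u i‖ ^ 2)

/-- The functional `P(u) = ∫_{ℝⁿ} max_i exp (-|x - u i|²) dx`. -/
def codeP {n : ℕ} {ι : Type*} (u : ι → EuclideanSpace ℝ (Fin n)) : ℝ :=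
  ∫ x, maxGauss u x

/-- The antipodal family `v₁, …, v_N, -v₁, …, -v_N`. -/
def antipodal {n N : ℕ} (v : Fin N → EuclideanSpace ℝ (Fin n)) :
    Fin N ⊕ Fin N → EuclideanSpace ℝ (Fin n) :=
  Sum.elim v (fun i => -v i)

/-- The families `v₁, …, v_N` of vectors of `ℝⁿ` with prescribed lengths `|v i| = r i`. -/
def prescribedLengths (n : ℕ) {N : ℕ} (r : Fin N → ℝ) :
    Set (Fin N → EuclideanSpace ℝ (Fin n)) :=
  {v | ∀ i, ‖v i‖ = r i}

/-- The members of the family are orthogonal to each other (zero vectors are allowed). -/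
def PairwiseOrthogonal {n N : ℕ} (v : Fin N → EuclideanSpace ℝ (Fin n)) : Prop :=
  Pairwise fun i j => inner ℝ (v i) (v j) = 0

end

/-!
For `t > 0` the inequality `max_i exp (-|x ± v i|²) ≤ t exp (-|x|²)` says that `x` lies in every
slab `|⟨v i, x⟩| ≤ (log t + |v i|²) / 2`. By the layer-cake formula, `P (v, -v)` is therefore a
constant times the integral over `t` of the Gaussian measure of the complement of such an
intersection, and it suffices that, for given lengths and widths, an intersection of symmetric slabs
has the least Gaussian measure when the normals are orthogonal. In the orthogonal case the slabs are
independent events, and in general the measure of their intersection is at least the product of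
their measures (Šidák's inequality).

Šidák's inequality reduces to the positive correlation of a symmetric convex set `K` with one slab
`|⟨v, x⟩| ≤ c`. The component of `x` orthogonal to `v` is independent of `⟨v, x⟩`, so this holds as
soon as the Gaussian measure of the section of `K` over `⟨v, x⟩ = t` is largest at the centre,
decreasing in `|t|`: the section measure is even by symmetry, and log-concave in `t` by the
Prékopa–Leindler inequality. The latter passes to products, log-concave densities and linear images,
hence follows for the Gaussian measure from the one-dimensional inequality, which is the
Brunn–Minkowski inequality on the line applied to superlevel sets.
-/

open ProbabilityTheory Set
open scoped ENNReal Pointwise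

/-! ### The Prékopa–Leindler inequality -/

section PrekopaLeindler

/-- The Prékopa–Leindler inequality for the measure `μ`, the functional form of log-concavity.
No integrability or boundedness is asked of the functions, since they take values in `[0, ∞]`. -/
def PrekopaLeindler {E : Type*} [AddCommGroup E] [Module ℝ E] [MeasurableSpace E]
    (μ : Measure E) : Prop :=
  ∀ ⦃a b : ℝ⦄, 0 < a → 0 < b → a + b = 1 → ∀ ⦃f g h : E → ℝ≥0∞⦄,
    Measurable f → Measurable g → Measurable h →
    (∀ x y, f x ^ a * g y ^ b ≤ h (a • x + b • y)) →
    (∫⁻ x, f x ∂μ) ^ a * (∫⁻ x, g x ∂μ) ^ b ≤ ∫⁻ x, h x ∂μ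

theorem volume_add_volume_le_volume_add_of_isCompact {A B : Set ℝ} (hA : IsCompact A)
    (hB : IsCompact B) (hA' : A.Nonempty) (hB' : B.Nonempty) :
    volume A + volume B ≤ volume (A + B) := by
  obtain ⟨α, hαA, hα⟩ := hA.exists_isGreatest hA'
  obtain ⟨β, hβB, hβ⟩ := hB.exists_isLeast hB'
  -- `A + β` lies to the left of `α + β` and `α + B` to its right, and both lie in `A + B`.
  have hdisj : AEDisjoint volume (β +ᵥ A) (α +ᵥ B) := by
    refine measure_mono_null (t := {α + β}) ?_ (by simp)
    rintro _ ⟨⟨x, hx, rfl⟩, ⟨y, hy, hxy⟩⟩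
    simp only [vadd_eq_add, mem_singleton_iff] at hxy ⊢
    linarith [hα hx, hβ hy]
  calc volume A + volume B = volume (β +ᵥ A) + volume (α +ᵥ B) := by simp only [measure_vadd]
    _ = volume ((β +ᵥ A) ∪ (α +ᵥ B)) :=
        (measure_union₀ (hB.vadd α).measurableSet.nullMeasurableSet hdisj).symm
    _ ≤ volume (A + B) := by
        refine measure_mono (union_subset ?_ ?_)
        · rintro _ ⟨x, hx, rfl⟩
          exact ⟨x, hx, β, hβB, add_comm x β⟩
        · rintro _ ⟨y, hy, rfl⟩
          exact ⟨α, hαA, y, hy, rfl⟩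

theorem volume_add_volume_le_volume_add {A B : Set ℝ} (hA : MeasurableSet A)
    (hB : MeasurableSet B) (hA' : A.Nonempty) (hB' : B.Nonempty) :
    volume A + volume B ≤ volume (A + B) := by
  obtain ⟨x₀, hx₀⟩ := hA'
  obtain ⟨y₀, hy₀⟩ := hB'
  have inner_regular {S : Set ℝ} (hS : MeasurableSet S) :
      volume S = ⨆ K : {K : Set ℝ // K ⊆ S ∧ IsCompact K}, volume (K : Set ℝ) := by
    simp only [hS.measure_eq_iSup_isCompact, iSup_subtype, iSup_and]
  have nonempty_compacts (S : Set ℝ) : Nonempty {K : Set ℝ // K ⊆ S ∧ IsCompact K} :=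
    ⟨∅, empty_subset S, isCompact_empty⟩
  rw [inner_regular hA, inner_regular hB]
  refine ENNReal.iSup_add_iSup_le fun ⟨K, hKA, hK⟩ ⟨L, hLB, hL⟩ => ?_
  calc volume K + volume L ≤ volume (insert x₀ K) + volume (insert y₀ L) := by
        gcongr <;> exact subset_insert _ _
    _ ≤ volume (insert x₀ K + insert y₀ L) :=
        volume_add_volume_le_volume_add_of_isCompact (hK.insert x₀) (hL.insert y₀)
          (insert_nonempty x₀ K) (insert_nonempty y₀ L)
    _ ≤ volume (A + B) :=
        measure_mono (add_subset_add (insert_subset hx₀ hKA) (insert_subset hy₀ hLB))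

theorem rpow_mul_rpow_le_ofReal_mul_add {a b : ℝ} (ha : 0 < a) (hb : 0 < b) (hab : a + b = 1)
    (p q : ℝ≥0∞) : p ^ a * q ^ b ≤ ENNReal.ofReal a * p + ENNReal.ofReal b * q := by
  have hconj : a⁻¹.HolderConjugate b⁻¹ := Real.holderConjugate_iff.2
    ⟨(one_lt_inv₀ ha).2 (by linarith), by rw [inv_inv, inv_inv, hab]⟩
  have := ENNReal.young_inequality (p ^ a) (q ^ b) hconj
  rwa [ENNReal.rpow_rpow_inv ha.ne', ENNReal.rpow_rpow_inv hb.ne', ENNReal.ofReal_inv_of_pos ha,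
    ENNReal.ofReal_inv_of_pos hb, div_eq_mul_inv, div_eq_mul_inv, inv_inv, inv_inv,
    mul_comm p, mul_comm q] at this

theorem lintegral_min_one_eq_lintegral_superlevel {α : Type*} [MeasurableSpace α] (μ : Measure α)
    {f : α → ℝ≥0∞} (hf : Measurable f) :
    ∫⁻ x, min (f x) 1 ∂μ = ∫⁻ t in Ioo (0 : ℝ) 1, μ {x | ENNReal.ofReal t < f x} := by
  have hfin (x : α) : min (f x) 1 ≠ ∞ := ne_top_of_le_ne_top ENNReal.one_ne_top (min_le_right _ _)
  have layer_cake := lintegral_eq_lintegral_meas_lt μ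
    (Filter.Eventually.of_forall fun x => (min (f x) 1).toReal_nonneg)
    (hf.min measurable_const).ennreal_toReal.aemeasurable
  simp only [ENNReal.ofReal_toReal (hfin _)] at layer_cake
  have hlevel {t : ℝ} (ht : 0 < t) (x : α) :
      t < (min (f x) 1).toReal ↔ ENNReal.ofReal t < f x ∧ t < 1 := by
    rw [← ENNReal.ofReal_lt_iff_lt_toReal ht.le (hfin x), lt_min_iff, ENNReal.ofReal_lt_one]
  have hlarge : ∫⁻ t in Ici (1 : ℝ), μ {x | t < (min (f x) 1).toReal} = 0 := by
    rw [setLIntegral_congr_fun (g := 0) measurableSet_Ici fun t ht => ?_]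
    · simp
    · simp [hlevel (one_pos.trans_le ht), (mem_Ici.1 ht).not_gt]
  rw [layer_cake, ← Ioo_union_Ici_eq_Ioi one_pos, lintegral_union measurableSet_Ici
    (disjoint_left.2 fun _ h1 h2 => h1.2.not_ge h2), hlarge, add_zero]
  refine setLIntegral_congr_fun measurableSet_Ioo fun t ht => ?_
  simp only [hlevel ht.1, ht.2, and_true]

theorem lintegral_eq_iSup_lintegral_min_natCast {α : Type*} [MeasurableSpace α] (μ : Measure α)
    {f : α → ℝ≥0∞} (hf : Measurable f) :
    ∫⁻ x, f x ∂μ = ⨆ n : ℕ, ∫⁻ x, min (f x) n ∂μ := by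
  rw [← lintegral_iSup (fun n => hf.min measurable_const)
    fun m n hmn x => min_le_min_left _ (Nat.cast_le.2 hmn)]
  simp only [← inf_iSup_eq, ENNReal.iSup_natCast, inf_top_eq]

section Real

variable {f g h : ℝ → ℝ≥0∞} {a b : ℝ}

theorem volume_superlevel_add_le (ha : 0 < a) (hb : 0 < b) (hab : a + b = 1)
    (hf : Measurable f) (hg : Measurable g) (H : ∀ x y, f x ^ a * g y ^ b ≤ h (a • x + b • y))
    {t : ℝ≥0∞} (htf : t < ⨆ x, f x) (htg : t < ⨆ x, g x) :
    ENNReal.ofReal a * volume {x | t < f x} + ENNReal.ofReal b * volume {x | t < g x} ≤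
      volume {x | t < h x} := by
  have volume_smul {c : ℝ} (hc : 0 < c) (S : Set ℝ) :
      ENNReal.ofReal c * volume S = volume (c • S) := by
    simp [Measure.addHaar_smul, abs_of_pos hc]
  have hsubset : a • {x | t < f x} + b • {x | t < g x} ⊆ {x | t < h x} := by
    rintro _ ⟨_, ⟨x, hx, rfl⟩, _, ⟨y, hy, rfl⟩, rfl⟩
    calc t = t ^ a * t ^ b := by
          rw [← ENNReal.rpow_add_of_nonneg _ _ ha.le hb.le, hab, ENNReal.rpow_one]
      _ < f x ^ a * g y ^ b :=
          ENNReal.mul_lt_mul (ENNReal.rpow_lt_rpow hx ha) (ENNReal.rpow_lt_rpow hy hb)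
      _ ≤ h (a • x + b • y) := H x y
  rw [volume_smul ha, volume_smul hb]
  refine (volume_add_volume_le_volume_add ?_ ?_ ?_ ?_).trans (measure_mono hsubset)
  · exact (measurableSet_lt measurable_const hf).const_smul_of_ne_zero ha.ne'
  · exact (measurableSet_lt measurable_const hg).const_smul_of_ne_zero hb.ne'
  · exact Nonempty.smul_set (lt_iSup_iff.1 htf)
  · exact Nonempty.smul_set (lt_iSup_iff.1 htg)

theorem lintegral_add_lintegral_le_of_iSup_eq_one (ha : 0 < a) (hb : 0 < b) (hab : a + b = 1)
    (hf : Measurable f) (hg : Measurable g) (hh : Measurable h)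
    (H : ∀ x y, f x ^ a * g y ^ b ≤ h (a • x + b • y))
    (hf1 : ⨆ x, f x = 1) (hg1 : ⨆ x, g x = 1) :
    ENNReal.ofReal a * (∫⁻ x, f x) + ENNReal.ofReal b * ∫⁻ x, g x ≤ ∫⁻ x, h x := by
  have hfg {k : ℝ → ℝ≥0∞} (hk : Measurable k) (hk1 : ⨆ x, k x = 1) :
      ∫⁻ x, k x = ∫⁻ t in Ioo (0 : ℝ) 1, volume {x | ENNReal.ofReal t < k x} := by
    rw [← lintegral_min_one_eq_lintegral_superlevel volume hk]
    exact lintegral_congr fun x => (min_eq_left (hk1 ▸ le_iSup k x)).symm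
  calc ENNReal.ofReal a * (∫⁻ x, f x) + ENNReal.ofReal b * ∫⁻ x, g x
      ≤ ∫⁻ t in Ioo (0 : ℝ) 1, (ENNReal.ofReal a * volume {x | ENNReal.ofReal t < f x} +
          ENNReal.ofReal b * volume {x | ENNReal.ofReal t < g x}) := by
        rw [hfg hf hf1, hfg hg hg1, ← lintegral_const_mul' _ _ ENNReal.ofReal_ne_top,
          ← lintegral_const_mul' _ _ ENNReal.ofReal_ne_top]
        exact le_lintegral_add _ _
    _ ≤ ∫⁻ t in Ioo (0 : ℝ) 1, volume {x | ENNReal.ofReal t < h x} := by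
        refine setLIntegral_mono' measurableSet_Ioo fun t ht => ?_
        have ht1 : ENNReal.ofReal t < 1 := ENNReal.ofReal_lt_one.2 ht.2
        exact volume_superlevel_add_le ha hb hab hf hg H (ht1.trans_eq hf1.symm)
          (ht1.trans_eq hg1.symm)
    _ = ∫⁻ x, min (h x) 1 := (lintegral_min_one_eq_lintegral_superlevel volume hh).symm
    _ ≤ ∫⁻ x, h x := lintegral_mono fun x => min_le_left _ _

theorem lintegral_rpow_mul_lintegral_rpow_le_of_iSup_ne_top (ha : 0 < a) (hb : 0 < b)
    (hab : a + b = 1) (hf : Measurable f) (hg : Measurable g) (hh : Measurable h)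
    (H : ∀ x y, f x ^ a * g y ^ b ≤ h (a • x + b • y))
    (hf_top : ⨆ x, f x ≠ ∞) (hg_top : ⨆ x, g x ≠ ∞) :
    (∫⁻ x, f x) ^ a * (∫⁻ x, g x) ^ b ≤ ∫⁻ x, h x := by
  set M := ⨆ x, f x with hM
  set L := ⨆ x, g x with hL
  rcases eq_or_ne M 0 with hM0 | hM0
  · simp [ENNReal.iSup_eq_zero.1 hM0, ha]
  rcases eq_or_ne L 0 with hL0 | hL0
  · simp [ENNReal.iSup_eq_zero.1 hL0, hb]
  -- Replacing `f`, `g`, `h` by `f / M`, `g / L`, `h / (M ^ a * L ^ b)` makes both suprema one.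
  set D := (M ^ a * L ^ b)⁻¹ with hD
  have hMa : M ^ a ≠ 0 ∧ M ^ a ≠ ∞ := by simp [hM0, hf_top, ha]
  have hLb : L ^ b ≠ 0 ∧ L ^ b ≠ ∞ := by simp [hL0, hg_top, hb]
  have hscale (p q : ℝ≥0∞) : (M⁻¹ * p) ^ a * (L⁻¹ * q) ^ b = D * (p ^ a * q ^ b) := by
    rw [ENNReal.mul_rpow_of_nonneg _ _ ha.le, ENNReal.mul_rpow_of_nonneg _ _ hb.le,
      ENNReal.inv_rpow, ENNReal.inv_rpow, hD, ENNReal.mul_inv (.inl hMa.1) (.inl hMa.2)]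
    ring
  have hnormalized : D * ((∫⁻ x, f x) ^ a * (∫⁻ x, g x) ^ b) ≤ D * ∫⁻ x, h x := by
    rw [← hscale, ← lintegral_const_mul _ hf, ← lintegral_const_mul _ hg,
      ← lintegral_const_mul _ hh]
    refine (rpow_mul_rpow_le_ofReal_mul_add ha hb hab _ _).trans
      (lintegral_add_lintegral_le_of_iSup_eq_one ha hb hab (hf.const_mul _) (hg.const_mul _)
        (hh.const_mul _) (fun x y => ?_) ?_ ?_)
    · rw [hscale]
      gcongr
      exact H x y
    · rw [← ENNReal.mul_iSup, ← hM, ENNReal.inv_mul_cancel hM0 hf_top]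
    · rw [← ENNReal.mul_iSup, ← hL, ENNReal.inv_mul_cancel hL0 hg_top]
  refine (ENNReal.mul_le_mul_iff_right ?_ ?_).1 hnormalized
  · simp [hD, ENNReal.mul_eq_top, hMa, hLb]
  · simp [hD, hMa, hLb]

end Real

theorem prekopaLeindler_volume_real : PrekopaLeindler (volume : Measure ℝ) := by
  intro a b ha hb hab f g h hf hg hh H
  have hbounded (k : ℝ → ℝ≥0∞) (n : ℕ) : ⨆ x, min (k x) n ≠ ∞ :=
    ne_top_of_le_ne_top (ENNReal.natCast_ne_top n) (iSup_le fun x => min_le_right _ _)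
  have iSup_rpow {c : ℝ} (hc : 0 < c) (u : ℕ → ℝ≥0∞) : (⨆ n, u n) ^ c = ⨆ n, u n ^ c :=
    (ENNReal.orderIsoRpow c hc).map_iSup u
  rw [lintegral_eq_iSup_lintegral_min_natCast _ hf, lintegral_eq_iSup_lintegral_min_natCast _ hg,
    iSup_rpow ha, iSup_rpow hb, ENNReal.iSup_mul]
  simp only [ENNReal.mul_iSup, iSup_le_iff]
  intro m n
  refine lintegral_rpow_mul_lintegral_rpow_le_of_iSup_ne_top ha hb hab (hf.min measurable_const)
    (hg.min measurable_const) hh (fun x y => le_trans ?_ (H x y)) (hbounded f m) (hbounded g n)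
  gcongr <;> exact min_le_left _ _

namespace PrekopaLeindler

variable {E F : Type*} [AddCommGroup E] [Module ℝ E] [MeasurableSpace E]
  [AddCommGroup F] [Module ℝ F] [MeasurableSpace F]

theorem map {μ : Measure E} (hμ : PrekopaLeindler μ) {T : E →ₗ[ℝ] F} (hT : Measurable T) :
    PrekopaLeindler (μ.map T) := by
  intro a b ha hb hab f g h hf hg hh H
  rw [lintegral_map hf hT, lintegral_map hg hT, lintegral_map hh hT]
  refine hμ ha hb hab (hf.comp hT) (hg.comp hT) (hh.comp hT) fun x y => ?_
  simpa only [Function.comp_apply, map_add, map_smul] using H (T x) (T y)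

theorem withDensity {μ : Measure E} (hμ : PrekopaLeindler μ) {p : E → ℝ≥0∞} (hp : Measurable p)
    (hlog : ∀ ⦃a b : ℝ⦄, 0 < a → 0 < b → a + b = 1 → ∀ x y, p x ^ a * p y ^ b ≤ p (a • x + b • y)) :
    PrekopaLeindler (μ.withDensity p) := by
  intro a b ha hb hab f g h hf hg hh H
  rw [lintegral_withDensity_eq_lintegral_mul _ hp hf,
    lintegral_withDensity_eq_lintegral_mul _ hp hg, lintegral_withDensity_eq_lintegral_mul _ hp hh]
  refine hμ ha hb hab (hp.mul hf) (hp.mul hg) (hp.mul hh) fun x y => ?_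
  simp only [Pi.mul_apply]
  rw [ENNReal.mul_rpow_of_nonneg _ _ ha.le, ENNReal.mul_rpow_of_nonneg _ _ hb.le,
    mul_mul_mul_comm]
  exact mul_le_mul' (hlog ha hb hab x y) (H x y)

theorem prod {μ : Measure E} {ν : Measure F} [SFinite ν] (hμ : PrekopaLeindler μ)
    (hν : PrekopaLeindler ν) : PrekopaLeindler (μ.prod ν) := by
  intro a b ha hb hab f g h hf hg hh H
  rw [lintegral_prod _ hf.aemeasurable, lintegral_prod _ hg.aemeasurable,
    lintegral_prod _ hh.aemeasurable]
  refine hμ ha hb hab hf.lintegral_prod_right' hg.lintegral_prod_right' hh.lintegral_prod_right'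
    fun x x' => ?_
  exact hν ha hb hab (hf.comp measurable_prodMk_left) (hg.comp measurable_prodMk_left)
    (hh.comp measurable_prodMk_left) fun y y' => H (x, y) (x', y')

theorem dirac_zero : PrekopaLeindler (Measure.dirac (0 : E)) := by
  intro a b _ _ _ f g h hf hg hh H
  simpa only [lintegral_dirac' _ hf, lintegral_dirac' _ hg, lintegral_dirac' _ hh, smul_zero,
    add_zero] using H 0 0

theorem pi {m : ℕ} {E : Fin m → Type*} [∀ i, AddCommGroup (E i)] [∀ i, Module ℝ (E i)]
    [∀ i, MeasurableSpace (E i)] {μ : ∀ i, Measure (E i)} [∀ i, SigmaFinite (μ i)]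
    (hμ : ∀ i, PrekopaLeindler (μ i)) : PrekopaLeindler (Measure.pi μ) := by
  induction m with
  | zero =>
    rw [Measure.pi_of_empty μ 0]
    exact dirac_zero
  | succ m ih =>
    have hcons : ⇑(MeasurableEquiv.piFinSuccAbove E 0).symm =
        (Fin.consLinearEquiv ℝ E).toLinearMap := by
      ext z i
      cases i using Fin.cases <;> rfl
    have hmp := (measurePreserving_piFinSuccAbove μ 0).symm
    rw [hcons] at hmp
    rw [← hmp.map_eq]
    exact ((hμ 0).prod (ih fun i => hμ i.succ)).map hmp.measurable

end PrekopaLeindler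

theorem prekopaLeindler_gaussianReal (m : ℝ) {v : NNReal} (hv : v ≠ 0) :
    PrekopaLeindler (gaussianReal m v) := by
  rw [gaussianReal_of_var_ne_zero m hv]
  refine prekopaLeindler_volume_real.withDensity (measurable_gaussianPDF m v)
    fun a b ha hb hab x y => ?_
  set K : ℝ := (√(2 * Real.pi * v))⁻¹
  have hK : 0 ≤ K := by positivity
  have hexponent : -(x - m) ^ 2 / (2 * v) * a + -(y - m) ^ 2 / (2 * v) * b ≤
      -(a • x + b • y - m) ^ 2 / (2 * v) := by
    have hconvex : (a • x + b • y - m) ^ 2 ≤ (x - m) ^ 2 * a + (y - m) ^ 2 * b := by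
      obtain rfl : b = 1 - a := by linarith
      simp only [smul_eq_mul]
      nlinarith [mul_nonneg (mul_nonneg ha.le hb.le) (sq_nonneg (x - y))]
    rw [div_mul_eq_mul_div, div_mul_eq_mul_div, ← add_div]
    gcongr
    linarith
  simp only [gaussianPDF, gaussianPDFReal]
  rw [ENNReal.ofReal_rpow_of_nonneg (by positivity) ha.le,
    ENNReal.ofReal_rpow_of_nonneg (by positivity) hb.le, ← ENNReal.ofReal_mul (by positivity)]
  refine ENNReal.ofReal_le_ofReal ?_
  calc (K * Real.exp (-(x - m) ^ 2 / (2 * v))) ^ a * (K * Real.exp (-(y - m) ^ 2 / (2 * v))) ^ b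
      = (K ^ a * K ^ b) *
          Real.exp (-(x - m) ^ 2 / (2 * v) * a + -(y - m) ^ 2 / (2 * v) * b) := by
        rw [Real.mul_rpow hK (Real.exp_nonneg _), Real.mul_rpow hK (Real.exp_nonneg _),
          ← Real.exp_mul, ← Real.exp_mul, mul_mul_mul_comm, ← Real.exp_add]
    _ = K * Real.exp (-(x - m) ^ 2 / (2 * v) * a + -(y - m) ^ 2 / (2 * v) * b) := by
        rw [← Real.rpow_add_of_nonneg hK ha.le hb.le, hab, Real.rpow_one]
    _ ≤ K * Real.exp (-(a • x + b • y - m) ^ 2 / (2 * v)) := by gcongr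

theorem prekopaLeindler_stdGaussian {E : Type*} [NormedAddCommGroup E] [InnerProductSpace ℝ E]
    [FiniteDimensional ℝ E] [MeasurableSpace E] [BorelSpace E] :
    PrekopaLeindler (stdGaussian E) := by
  have hT (x : Fin (Module.finrank ℝ E) → ℝ) : ∑ i, x i • stdOrthonormalBasis ℝ E i =
      Fintype.linearCombination ℝ (stdOrthonormalBasis ℝ E) x :=
    (Fintype.linearCombination_apply ℝ _ x).symm
  simp only [stdGaussian, hT]
  exact (PrekopaLeindler.pi fun _ => prekopaLeindler_gaussianReal 0 one_ne_zero).map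
    (LinearMap.continuous_of_finiteDimensional _).measurable

end PrekopaLeindler

/-! ### Šidák's inequality -/

section Correlation

theorem measure_mul_lintegral_le_setLIntegral {α : Type*} [MeasurableSpace α] (μ : Measure α)
    [IsProbabilityMeasure μ] {S : Set α} (hS : MeasurableSet S) {φ : α → ℝ≥0∞} {d : ℝ≥0∞}
    (h_mem : ∀ x ∈ S, d ≤ φ x) (h_notMem : ∀ x ∉ S, φ x ≤ d) :
    (∫⁻ x, φ x ∂μ) * μ S ≤ ∫⁻ x in S, φ x ∂μ := by
  have hle : d * μ S ≤ ∫⁻ x in S, φ x ∂μ := by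
    rw [← setLIntegral_const]
    exact setLIntegral_mono' hS h_mem
  have hge : ∫⁻ x in Sᶜ, φ x ∂μ ≤ d * μ Sᶜ := by
    rw [← setLIntegral_const]
    exact setLIntegral_mono' hS.compl h_notMem
  calc (∫⁻ x, φ x ∂μ) * μ S
      = (∫⁻ x in S, φ x ∂μ) * μ S + (∫⁻ x in Sᶜ, φ x ∂μ) * μ S := by
        rw [← lintegral_add_compl φ hS, add_mul]
    _ ≤ (∫⁻ x in S, φ x ∂μ) * μ S + (d * μ Sᶜ) * μ S := by gcongr
    _ = (∫⁻ x in S, φ x ∂μ) * μ S + (d * μ S) * μ Sᶜ := by ring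
    _ ≤ (∫⁻ x in S, φ x ∂μ) * μ S + (∫⁻ x in S, φ x ∂μ) * μ Sᶜ := by gcongr
    _ = ∫⁻ x in S, φ x ∂μ := by
        rw [← mul_add, measure_add_measure_compl hS, measure_univ, mul_one]

namespace PrekopaLeindler

variable {E : Type*} [AddCommGroup E] [Module ℝ E] [MeasurableSpace E] {μ : Measure E}

theorem measure_rpow_mul_measure_rpow_le (hμ : PrekopaLeindler μ) {a b : ℝ} (ha : 0 < a)
    (hb : 0 < b) (hab : a + b = 1) {A B C : Set E} (hA : MeasurableSet A) (hB : MeasurableSet B)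
    (hC : MeasurableSet C) (H : ∀ x ∈ A, ∀ y ∈ B, a • x + b • y ∈ C) :
    μ A ^ a * μ B ^ b ≤ μ C := by
  simp only [← lintegral_indicator_one hA, ← lintegral_indicator_one hB,
    ← lintegral_indicator_one hC]
  refine hμ ha hb hab (measurable_one.indicator hA) (measurable_one.indicator hB)
    (measurable_one.indicator hC) fun x y => ?_
  by_cases hx : x ∈ A
  · by_cases hy : y ∈ B
    · simp [hx, hy, H x hx y hy]
    · simp [hy, hb]
  · simp [hx, ha]

variable [MeasurableNeg E] [μ.IsNegInvariant] {C : Set (E × ℝ)}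

theorem measure_section_le_of_abs_le (hμ : PrekopaLeindler μ) (hC : MeasurableSet C)
    (hconv : Convex ℝ C) (hsymm : ∀ z ∈ C, -z ∈ C) {s t : ℝ} (hst : |s| ≤ |t|) :
    μ ((·, t) ⁻¹' C) ≤ μ ((·, s) ⁻¹' C) := by
  have hmeas (r : ℝ) : MeasurableSet ((·, r) ⁻¹' C : Set E) := measurable_prodMk_right hC
  have heven (r : ℝ) : μ ((·, -r) ⁻¹' C) = μ ((·, r) ⁻¹' C) := by
    rw [← Measure.measure_neg]
    congr 1
    ext x
    exact ⟨fun h => by simpa using hsymm _ h, fun h => hsymm _ h⟩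
  have hmem : s ∈ segment ℝ (-t) t := by
    rcases le_total 0 t with ht | ht
    · rw [abs_of_nonneg ht] at hst
      simpa only [segment_eq_uIcc, uIcc_of_le (neg_le_self ht), mem_Icc] using abs_le.1 hst
    · rw [abs_of_nonpos ht] at hst
      simpa only [segment_eq_uIcc, uIcc_of_ge (ht.trans (neg_nonneg.2 ht)), mem_Icc, neg_neg] using
        abs_le.1 hst
  rw [← insert_endpoints_openSegment] at hmem
  obtain rfl | rfl | ⟨a, b, ha, hb, hab, rfl⟩ := hmem
  · exact (heven t).ge
  · exact le_rfl
  · calc μ ((·, t) ⁻¹' C) = μ ((·, -t) ⁻¹' C) ^ a * μ ((·, t) ⁻¹' C) ^ b := by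
          rw [heven, ← ENNReal.rpow_add_of_nonneg _ _ ha.le hb.le, hab, ENNReal.rpow_one]
      _ ≤ μ ((·, a • -t + b • t) ⁻¹' C) :=
          hμ.measure_rpow_mul_measure_rpow_le ha hb hab (hmeas _) (hmeas _) (hmeas _)
            fun x hx y hy => hconv hx hy ha.le hb.le hab

theorem prod_mul_measure_Icc_le [SFinite μ] (hμ : PrekopaLeindler μ) (ν : Measure ℝ)
    [IsProbabilityMeasure ν] (hC : MeasurableSet C) (hconv : Convex ℝ C)
    (hsymm : ∀ z ∈ C, -z ∈ C) (c : ℝ) :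
    μ.prod ν C * ν (Icc (-c) c) ≤ μ.prod ν (C ∩ Prod.snd ⁻¹' Icc (-c) c) := by
  rcases lt_or_ge c 0 with hc | hc
  · simp [Icc_eq_empty_of_lt (hc.trans (neg_pos.2 hc))]
  rw [← univ_prod, ← Measure.restrict_apply hC, ← Measure.prod_restrict, Measure.restrict_univ,
    Measure.prod_apply_symm hC, Measure.prod_apply_symm hC]
  refine measure_mul_lintegral_le_setLIntegral ν measurableSet_Icc
    (d := μ ((·, c) ⁻¹' C)) (fun t ht => ?_) (fun t ht => ?_)
  · exact hμ.measure_section_le_of_abs_le hC hconv hsymm ((abs_le.2 ht).trans (le_abs_self c))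
  · refine hμ.measure_section_le_of_abs_le hC hconv hsymm ?_
    rw [abs_of_nonneg hc]
    exact (not_le.1 fun h => ht (abs_le.1 h)).le

end PrekopaLeindler

end Correlation

section Slab

variable {E : Type*} [NormedAddCommGroup E] [InnerProductSpace ℝ E]

/-- The closed slab of half-width `c / ‖u‖` around the hyperplane through `0` orthogonal to `u`.
It is empty for `c < 0`, and everything for `u = 0 ≤ c`. The sublevel sets of `maxGauss` for an
antipodal family, relative to `exp (-‖x‖²)`, are intersections of slabs. -/
def slab (u : E) (c : ℝ) : Set E := {x | |inner ℝ u x| ≤ c}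

theorem slab_eq_preimage (u : E) (c : ℝ) :
    slab u c = (fun x => inner ℝ u x) ⁻¹' Icc (-c) c :=
  ext fun _ => by simp only [slab, mem_ofPred_eq, abs_le, mem_preimage, mem_Icc]

theorem convex_slab (u : E) (c : ℝ) : Convex ℝ (slab u c) := by
  rw [slab_eq_preimage]
  exact (convex_Icc _ _).linear_preimage (innerₗ E u)

theorem neg_mem_slab {u x : E} {c : ℝ} (hx : x ∈ slab u c) : -x ∈ slab u c := by
  simpa [slab] using hx

theorem smul_mem_slab_iff {a : ℝ} (ha : 0 < a) {u x : E} {c : ℝ} :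
    a • x ∈ slab u c ↔ x ∈ slab u (a⁻¹ * c) := by
  simp only [slab, mem_ofPred_eq, real_inner_smul_right, abs_mul, abs_of_pos ha,
    le_inv_mul_iff₀ ha]

variable [MeasurableSpace E] [BorelSpace E]

theorem measurableSet_slab (u : E) (c : ℝ) : MeasurableSet (slab u c) :=
  (isClosed_le (by fun_prop) continuous_const).measurableSet

end Slab

-- This includes `v = 0`, where the junk value `(‖v‖ ^ 2)⁻¹ = 0` is harmless.
theorem starProjection_orthogonal_add_inner_smul {E : Type*} [NormedAddCommGroup E]
    [InnerProductSpace ℝ E] (v x : E) :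
    (ℝ ∙ v)ᗮ.starProjection x + inner ℝ v x • (‖v‖ ^ 2)⁻¹ • v = x := by
  rw [Submodule.starProjection_orthogonal_val, Submodule.starProjection_singleton,
    RCLike.ofReal_real_eq_id, id, div_eq_mul_inv, mul_smul, sub_add_cancel]

section StdGaussian

variable {E F G : Type*} [NormedAddCommGroup E] [InnerProductSpace ℝ E] [FiniteDimensional ℝ E]
  [MeasurableSpace E] [BorelSpace E]

instance isNegInvariant_stdGaussian : (stdGaussian E).IsNegInvariant :=
  ⟨stdGaussian_map (LinearIsometryEquiv.neg ℝ)⟩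

theorem hasGaussianLaw_id_stdGaussian : HasGaussianLaw (id : E → E) (stdGaussian E) := by
  have : IsGaussian ((stdGaussian E).map id) := by rw [Measure.map_id]; infer_instance
  exact IsGaussian.hasGaussianLaw

theorem covariance_inner_stdGaussian (u w : E) :
    cov[fun x => inner ℝ u x, fun x => inner ℝ w x; stdGaussian E] = inner ℝ u w := by
  rw [← covarianceBilin_apply_eq_cov IsGaussian.memLp_two_id, covarianceBilin_stdGaussian,
    innerSL_apply_apply]

theorem map_inner_stdGaussian (u : E) :
    (stdGaussian E).map (fun x => inner ℝ u x) = gaussianReal 0 (‖u‖ ^ 2).toNNReal := by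
  have h := IsGaussian.map_eq_gaussianReal (μ := stdGaussian E) (innerSL ℝ u)
  rw [integral_strongDual_stdGaussian, variance_dual_stdGaussian, innerSL_apply_norm] at h
  exact h

theorem stdGaussian_slab (u : E) (c : ℝ) :
    stdGaussian E (slab u c) = gaussianReal 0 (‖u‖ ^ 2).toNNReal (Icc (-c) c) := by
  rw [← map_inner_stdGaussian, Measure.map_apply (by fun_prop) measurableSet_Icc,
    slab_eq_preimage]

open ContinuousLinearMap in
theorem indepFun_stdGaussian [NormedAddCommGroup F] [InnerProductSpace ℝ F]
    [FiniteDimensional ℝ F] [MeasurableSpace F] [BorelSpace F] [NormedAddCommGroup G]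
    [InnerProductSpace ℝ G] [FiniteDimensional ℝ G] [MeasurableSpace G] [BorelSpace G]
    {A : E →L[ℝ] F} {B : E →L[ℝ] G} (hAB : A ∘L adjoint B = 0) :
    IndepFun A B (stdGaussian E) := by
  have hlaw : HasGaussianLaw (fun x => (A x, B x)) (stdGaussian E) :=
    hasGaussianLaw_id_stdGaussian.map (A.prod B)
  refine hlaw.indepFun_of_covariance_inner fun y z => ?_
  simp only [← adjoint_inner_left A, ← adjoint_inner_left B, covariance_inner_stdGaussian]
  calc inner ℝ (adjoint A y) (adjoint B z) = inner ℝ y (A (adjoint B z)) := adjoint_inner_left ..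
    _ = 0 := by rw [← comp_apply A, hAB, zero_apply, inner_zero_right]

theorem indepFun_starProjection_orthogonal_inner_stdGaussian (v : E) :
    IndepFun (ℝ ∙ v)ᗮ.starProjection (innerSL ℝ v) (stdGaussian E) := by
  refine indepFun_stdGaussian ?_
  ext
  rw [ContinuousLinearMap.adjoint_innerSL_apply, ContinuousLinearMap.comp_apply,
    ContinuousLinearMap.toSpanSingleton_apply, one_smul,
    Submodule.starProjection_orthogonalComplement_singleton_eq_zero,
    zero_apply]

theorem map_prodMk_inner_stdGaussian (v : E) :
    (stdGaussian E).map (fun x => (x, inner ℝ v x)) =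
      ((stdGaussian E).prod ((stdGaussian E).map fun x => inner ℝ v x)).map
        fun z => ((ℝ ∙ v)ᗮ.starProjection z.1 + z.2 • (‖v‖ ^ 2)⁻¹ • v, z.2) := by
  set ν := (stdGaussian E).map fun x => inner ℝ v x
  set P := (ℝ ∙ v)ᗮ.starProjection
  set R : E × ℝ → E × ℝ := fun z => (z.1 + z.2 • (‖v‖ ^ 2)⁻¹ • v, z.2)
  have hR : Measurable R := by fun_prop
  have hlaw : (stdGaussian E).map (fun x => (P x, inner ℝ v x)) =
      ((stdGaussian E).map P).prod ν :=
    (indepFun_iff_map_prod_eq_prod_map_map (by fun_prop) (by fun_prop)).1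
      (indepFun_starProjection_orthogonal_inner_stdGaussian v)
  calc (stdGaussian E).map (fun x => (x, inner ℝ v x))
      = ((stdGaussian E).map fun x => (P x, inner ℝ v x)).map R := by
        rw [Measure.map_map hR (by fun_prop)]
        simp only [Function.comp_def, R, P, starProjection_orthogonal_add_inner_smul]
    _ = (((stdGaussian E).prod ν).map (Prod.map P id)).map R := by
        rw [hlaw, ← Measure.map_prod_map _ _ (by fun_prop) measurable_id, Measure.map_id]
    _ = ((stdGaussian E).prod ν).map (fun z => (P z.1 + z.2 • (‖v‖ ^ 2)⁻¹ • v, z.2)) :=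
        Measure.map_map hR (by fun_prop)

theorem stdGaussian_mul_slab_le (v : E) {K : Set E} (hK : MeasurableSet K) (hconv : Convex ℝ K)
    (hsymm : ∀ x ∈ K, -x ∈ K) (c : ℝ) :
    stdGaussian E K * stdGaussian E (slab v c) ≤ stdGaussian E (K ∩ slab v c) := by
  set ν := (stdGaussian E).map fun x => inner ℝ v x
  have : IsProbabilityMeasure ν := Measure.isProbabilityMeasure_map (by fun_prop)
  set T : E × ℝ →L[ℝ] E := (ℝ ∙ v)ᗮ.starProjection ∘L .fst ℝ E ℝ +
    (ContinuousLinearMap.snd ℝ E ℝ).smulRight ((‖v‖ ^ 2)⁻¹ • v)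
  have hT : MeasurableSet (T ⁻¹' K) := T.measurable hK
  have disintegration {S : Set ℝ} (hS : MeasurableSet S) :
      stdGaussian E (K ∩ (fun x => inner ℝ v x) ⁻¹' S) =
        (stdGaussian E).prod ν (T ⁻¹' K ∩ Prod.snd ⁻¹' S) := by
    have hlaw := congrArg (· (K ×ˢ S)) (map_prodMk_inner_stdGaussian v)
    rwa [Measure.map_apply (by fun_prop) (hK.prod hS),
      Measure.map_apply (by fun_prop) (hK.prod hS)] at hlaw
  have hK_eq : stdGaussian E K = (stdGaussian E).prod ν (T ⁻¹' K) := by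
    simpa only [preimage_univ, inter_univ] using disintegration MeasurableSet.univ
  rw [slab_eq_preimage, disintegration measurableSet_Icc, hK_eq,
    ← Measure.map_apply (by fun_prop) measurableSet_Icc]
  refine prekopaLeindler_stdGaussian.prod_mul_measure_Icc_le ν hT
    (hconv.linear_preimage T.toLinearMap) (fun z hz => ?_) c
  simpa only [mem_preimage, map_neg] using hsymm _ hz

theorem prod_stdGaussian_slab_le {ι : Type*} (s : Finset ι) (v : ι → E) (c : ι → ℝ) :
    ∏ i ∈ s, stdGaussian E (slab (v i) (c i)) ≤ stdGaussian E (⋂ i ∈ s, slab (v i) (c i)) := by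
  classical
  induction s using Finset.induction_on with
  | empty => simp
  | insert j s hj ih =>
    rw [Finset.prod_insert hj, Finset.set_biInter_insert, inter_comm, mul_comm]
    refine (mul_le_mul_left ih _).trans (stdGaussian_mul_slab_le _ ?_ ?_ ?_ _)
    · exact s.measurableSet_biInter fun i _ => measurableSet_slab _ _
    · exact convex_iInter₂ fun i _ => convex_slab _ _
    · intro x hx
      simp only [mem_iInter] at hx ⊢
      exact fun i hi => neg_mem_slab (hx i hi)

theorem stdGaussian_iInter_slab_of_orthogonal {ι : Type*} [Fintype ι] {w : ι → E}
    (hw : Pairwise fun i j => inner ℝ (w i) (w j) = 0) (c : ι → ℝ) :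
    stdGaussian E (⋂ i, slab (w i) (c i)) = ∏ i, stdGaussian E (slab (w i) (c i)) := by
  have hlaw : HasGaussianLaw (fun (x : E) (i : ι) => (inner ℝ (w i) x : ℝ)) (stdGaussian E) :=
    hasGaussianLaw_id_stdGaussian.map (ContinuousLinearMap.pi fun i => innerSL ℝ (w i))
  have hindep := hlaw.iIndepFun_of_covariance_eq_zero fun i j hij => by
    rw [covariance_inner_stdGaussian, hw hij]
  have := hindep.measure_inter_preimage_eq_mul Finset.univ
    (sets := fun i => Icc (-c i) (c i)) fun i _ => measurableSet_Icc
  simpa only [slab_eq_preimage, Finset.mem_univ, iInter_true] using this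

theorem stdGaussian_iInter_slab_le {ι : Type*} [Finite ι] {v w : ι → E}
    (hvw : ∀ i, ‖w i‖ = ‖v i‖) (hw : Pairwise fun i j => inner ℝ (w i) (w j) = 0) (c : ι → ℝ) :
    stdGaussian E (⋂ i, slab (w i) (c i)) ≤ stdGaussian E (⋂ i, slab (v i) (c i)) := by
  have := Fintype.ofFinite ι
  calc stdGaussian E (⋂ i, slab (w i) (c i))
      = ∏ i, stdGaussian E (slab (v i) (c i)) := by
        simp only [stdGaussian_iInter_slab_of_orthogonal hw, stdGaussian_slab, hvw]
    _ ≤ stdGaussian E (⋂ i, slab (v i) (c i)) := by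
        simpa using prod_stdGaussian_slab_le Finset.univ v c

end StdGaussian

/-! ### Reduction of `codeP` to Gaussian slabs -/

section GaussianDensity

variable {E : Type*} [NormedAddCommGroup E] [InnerProductSpace ℝ E] [FiniteDimensional ℝ E]
  [MeasurableSpace E] [BorelSpace E] {b : ℝ}

theorem integrable_exp_neg_mul_sq_norm (hb : 0 < b) :
    Integrable fun x : E => Real.exp (-b * ‖x‖ ^ 2) := by
  have h := (GaussianFourier.integrable_cexp_neg_mul_sq_norm_add (V := E) (b := b)
    (by simpa using hb) 0 0).norm
  simpa [Complex.norm_exp, ← Complex.ofReal_pow] using h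

theorem charFun_withDensity_exp_neg_mul_sq_norm (hb : 0 < b) (t : E) :
    charFun (volume.withDensity fun x => ENNReal.ofReal (Real.exp (-b * ‖x‖ ^ 2))) t =
      (Real.pi / b) ^ (Module.finrank ℝ E / 2 : ℂ) * Complex.exp (-‖t‖ ^ 2 / (4 * b)) := by
  have hfourier := GaussianFourier.integral_cexp_neg_mul_sq_norm_add (V := E) (b := b)
    (by simpa using hb) Complex.I t
  rw [Complex.I_sq, neg_one_mul] at hfourier
  rw [charFun_apply, integral_withDensity_eq_integral_toReal_smul (by fun_prop)
    (Filter.Eventually.of_forall fun x => ENNReal.ofReal_lt_top), ← hfourier]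
  refine integral_congr_ae (Filter.Eventually.of_forall fun x => ?_)
  dsimp only
  rw [ENNReal.toReal_ofReal (Real.exp_nonneg _), Complex.exp_add, Complex.real_smul,
    real_inner_comm, mul_comm Complex.I]
  push_cast
  rfl

theorem withDensity_exp_neg_mul_sq_norm_eq_smul_map_stdGaussian (hb : 0 < b) :
    (volume.withDensity fun x : E => ENNReal.ofReal (Real.exp (-b * ‖x‖ ^ 2))) =
      ENNReal.ofReal ((Real.pi / b) ^ (Module.finrank ℝ E / 2 : ℝ)) •
        (stdGaussian E).map fun x => (√(2 * b))⁻¹ • x := by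
  have := isFiniteMeasure_withDensity_ofReal (integrable_exp_neg_mul_sq_norm (E := E) hb).2
  have := (stdGaussian E).map (fun x => (√(2 * b))⁻¹ • x) |>.smul_finite
    (c := ENNReal.ofReal ((Real.pi / b) ^ (Module.finrank ℝ E / 2 : ℝ))) ENNReal.ofReal_ne_top
  refine Measure.ext_of_charFun (funext fun t => ?_)
  rw [charFun_withDensity_exp_neg_mul_sq_norm hb]
  conv_rhs => rw [charFun_apply, integral_smul_measure, ← charFun_apply, charFun_map_smul,
    charFun_stdGaussian]
  rw [ENNReal.toReal_ofReal (by positivity), Complex.real_smul,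
    Complex.ofReal_cpow (by positivity)]
  have hnorm : ‖(√(2 * b))⁻¹ • t‖ ^ 2 = ‖t‖ ^ 2 / (2 * b) := by
    rw [norm_smul, mul_pow, norm_inv, inv_pow, Real.norm_eq_abs, sq_abs,
      Real.sq_sqrt (by positivity), inv_mul_eq_div]
  simp only [← Complex.ofReal_pow, hnorm]
  push_cast
  congr 2
  field_simp
  norm_num

end GaussianDensity

section CodeP

variable {n N : ℕ} {ι : Type*}

theorem maxGauss_nonneg (u : ι → EuclideanSpace ℝ (Fin n)) (x : EuclideanSpace ℝ (Fin n)) :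
    0 ≤ maxGauss u x :=
  Real.iSup_nonneg fun _ => (Real.exp_pos _).le

variable [Finite ι]

theorem maxGauss_le_iff {u : ι → EuclideanSpace ℝ (Fin n)} {x : EuclideanSpace ℝ (Fin n)} {s : ℝ}
    (hs : 0 ≤ s) : maxGauss u x ≤ s ↔ ∀ i, Real.exp (-‖x - u i‖ ^ 2) ≤ s :=
  ⟨fun h i => (le_ciSup (finite_range _).bddAbove i).trans h, fun h => Real.iSup_le h hs⟩

theorem measurable_maxGauss (u : ι → EuclideanSpace ℝ (Fin n)) : Measurable (maxGauss u) :=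
  Measurable.iSup fun i => by fun_prop

theorem integrable_maxGauss (u : ι → EuclideanSpace ℝ (Fin n)) : Integrable (maxGauss u) := by
  have := Fintype.ofFinite ι
  have hint (i : ι) : Integrable fun x => Real.exp (-‖x - u i‖ ^ 2) := by
    simpa only [neg_one_mul] using
      (integrable_exp_neg_mul_sq_norm one_pos).comp_sub_right (u i)
  refine (integrable_finsetSum Finset.univ fun i _ => hint i).mono'
    (measurable_maxGauss u).aestronglyMeasurable (Filter.Eventually.of_forall fun x => ?_)
  rw [Real.norm_of_nonneg (maxGauss_nonneg u x), maxGauss_le_iff (by positivity)]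
  exact fun i => Finset.single_le_sum (f := fun i => Real.exp (-‖x - u i‖ ^ 2))
    (fun j _ => (Real.exp_pos _).le) (Finset.mem_univ i)

theorem codeP_eq_toReal_lintegral (u : ι → EuclideanSpace ℝ (Fin n)) :
    codeP u = (∫⁻ x, ENNReal.ofReal (maxGauss u x)).toReal :=
  integral_eq_lintegral_of_nonneg_ae (Filter.Eventually.of_forall (maxGauss_nonneg u))
    (measurable_maxGauss u).aestronglyMeasurable

theorem lintegral_maxGauss_eq_lintegral_superlevel (u : ι → EuclideanSpace ℝ (Fin n)) :
    ∫⁻ x, ENNReal.ofReal (maxGauss u x) = ENNReal.ofReal (Real.pi ^ (n / 2 : ℝ)) *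
      ∫⁻ t in Ioi 0, stdGaussian (EuclideanSpace ℝ (Fin n))
        {x | t < Real.exp (‖(√2)⁻¹ • x‖ ^ 2) * maxGauss u ((√2)⁻¹ • x)} := by
  set F : EuclideanSpace ℝ (Fin n) → ℝ := fun x => Real.exp (‖x‖ ^ 2) * maxGauss u x
  have hF : Measurable F := Measurable.mul (by fun_prop) (measurable_maxGauss u)
  have hF0 (x) : 0 ≤ F x := mul_nonneg (Real.exp_nonneg _) (maxGauss_nonneg u x)
  have hdensity := withDensity_exp_neg_mul_sq_norm_eq_smul_map_stdGaussian
    (E := EuclideanSpace ℝ (Fin n)) one_pos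
  simp only [div_one, mul_one, finrank_euclideanSpace_fin, neg_one_mul] at hdensity
  calc ∫⁻ x, ENNReal.ofReal (maxGauss u x)
      = ∫⁻ x, ENNReal.ofReal (Real.exp (-‖x‖ ^ 2)) * ENNReal.ofReal (F x) := by
        simp only [F, ← ENNReal.ofReal_mul (Real.exp_nonneg _), ← mul_assoc, ← Real.exp_add,
          neg_add_cancel, Real.exp_zero, one_mul]
    _ = ∫⁻ x, ENNReal.ofReal (F x) ∂(volume.withDensity fun x =>
          ENNReal.ofReal (Real.exp (-‖x‖ ^ 2))) :=
        (lintegral_withDensity_eq_lintegral_mul _ (by fun_prop) hF.ennreal_ofReal).symm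
    _ = ENNReal.ofReal (Real.pi ^ (n / 2 : ℝ)) *
          ∫⁻ x, ENNReal.ofReal (F ((√2)⁻¹ • x)) ∂stdGaussian _ := by
        rw [hdensity, lintegral_smul_measure, lintegral_map hF.ennreal_ofReal (by fun_prop),
          smul_eq_mul]
    _ = _ := by
        rw [lintegral_eq_lintegral_meas_lt _ (Filter.Eventually.of_forall fun x => hF0 _)
          (hF.comp (by fun_prop)).aemeasurable]

theorem exp_mul_maxGauss_antipodal_le_iff (v : Fin N → EuclideanSpace ℝ (Fin n)) {t : ℝ}
    (ht : 0 < t) (x : EuclideanSpace ℝ (Fin n)) :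
    Real.exp (‖x‖ ^ 2) * maxGauss (antipodal v) x ≤ t ↔
      x ∈ ⋂ i, slab (v i) ((Real.log t + ‖v i‖ ^ 2) / 2) := by
  have hexp (u : EuclideanSpace ℝ (Fin n)) : Real.exp (-‖x - u‖ ^ 2) ≤ t / Real.exp (‖x‖ ^ 2) ↔
      2 * inner ℝ u x - ‖u‖ ^ 2 ≤ Real.log t := by
    rw [le_div_iff₀ (Real.exp_pos _), ← Real.exp_add, ← Real.le_log_iff_exp_le ht,
      norm_sub_sq_real, real_inner_comm]
    ring_nf
  rw [← le_div_iff₀' (Real.exp_pos _), maxGauss_le_iff (by positivity)]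
  simp only [hexp, Sum.forall, antipodal, Sum.elim_inl, Sum.elim_inr, norm_neg, inner_neg_left,
    mem_iInter, slab, mem_ofPred_eq, abs_le, ← forall_and]
  refine forall_congr' fun i => ⟨fun h => ⟨?_, ?_⟩, fun h => ⟨?_, ?_⟩⟩ <;> linarith [h.1, h.2]

theorem lintegral_maxGauss_antipodal_eq_lintegral_slab (v : Fin N → EuclideanSpace ℝ (Fin n)) :
    ∫⁻ x, ENNReal.ofReal (maxGauss (antipodal v) x) = ENNReal.ofReal (Real.pi ^ (n / 2 : ℝ)) *
      ∫⁻ t in Ioi 0, (1 - stdGaussian (EuclideanSpace ℝ (Fin n))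
        (⋂ i, slab (v i) (√2 * ((Real.log t + ‖v i‖ ^ 2) / 2)))) := by
  rw [lintegral_maxGauss_eq_lintegral_superlevel]
  congr 1
  refine setLIntegral_congr_fun measurableSet_Ioi fun t ht => ?_
  rw [← prob_compl_eq_one_sub (MeasurableSet.iInter fun i => measurableSet_slab _ _)]
  congr 1
  ext x
  rw [mem_ofPred_eq, ← not_le, exp_mul_maxGauss_antipodal_le_iff v ht]
  simp only [mem_compl_iff, mem_iInter, smul_mem_slab_iff (inv_pos.2 (Real.sqrt_pos.2 two_pos)),
    inv_inv]

theorem codeP_antipodal_le {v w : Fin N → EuclideanSpace ℝ (Fin n)}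
    (hvw : ∀ i, ‖w i‖ = ‖v i‖) (hw : PairwiseOrthogonal w) :
    codeP (antipodal v) ≤ codeP (antipodal w) := by
  rw [codeP_eq_toReal_lintegral, codeP_eq_toReal_lintegral]
  refine ENNReal.toReal_mono (integrable_maxGauss _).lintegral_lt_top.ne ?_
  simp only [lintegral_maxGauss_antipodal_eq_lintegral_slab, hvw]
  exact mul_le_mul' le_rfl (lintegral_mono fun t =>
    tsub_le_tsub_left (stdGaussian_iInter_slab_le hvw hw _) 1)

theorem exists_mem_prescribedLengths_pairwiseOrthogonal (hN : N ≤ n) {r : Fin N → ℝ}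
    (hr : ∀ i, 0 ≤ r i) : ∃ w ∈ prescribedLengths n r, PairwiseOrthogonal w := by
  refine ⟨fun i => EuclideanSpace.single (Fin.castLE hN i) (r i), fun i => ?_, fun i j hij => ?_⟩
  · simp [abs_of_nonneg (hr i)]
  · have hne : Fin.castLE hN i ≠ Fin.castLE hN j := (Fin.castLE_injective hN).ne hij
    simp [hne, EuclideanSpace.inner_single_left]

end CodeP

theorem mainTheorem1 {n N : ℕ} (hN : N ≤ n) (r : Fin N → ℝ) (hr : ∀ i, 0 ≤ r i) :
    (∀ v ∈ prescribedLengths n r, Integrable (maxGauss (antipodal v))) ∧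
    (∃ w ∈ prescribedLengths n r, PairwiseOrthogonal w) ∧
    (∀ w ∈ prescribedLengths n r, PairwiseOrthogonal w →
      IsMaxOn (fun v => codeP (antipodal v)) (prescribedLengths n r) w) :=
  ⟨fun _ _ => integrable_maxGauss _, exists_mem_prescribedLengths_pairwiseOrthogonal hN hr,
    fun _ hw hw_orth _ hv => codeP_antipodal_le (fun i => (hw i).trans (hv i).symm) hw_orth⟩
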